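/- A (single-source) network is a finite directed acyclic multigraph with a source $S$ without incoming edges and a nonempty set $\mathbf T\not\ni S$ of terminals without outgoing edges, such that every terminal is reachable from $S$ by a directed path, and every other vertex $V\neq S$ (an intermediate vertex) is reachable from $S$ and reaches some terminal. Let $\mathcal A$ be a finite alphabet with $|\mathcal A|\ge 2$; every edge carries one symbol of $\mathcal A$. A network code $\mathcal F$ assigns to every intermediate vertex $V$ a function from the words in $\mathcal A$ on the incoming edges of $V$ to the words in $\mathcal A$ on the outgoing edges of $V$. For a set $\mathcal U$ of edges, an integer $t\ge 0$, a terminal $T$ and a word $x$ on the outgoing edges of $S$, let $\Omega_{\mathcal F,T}(x)$ be the set of all words that can arrive on the incoming edges of $T$ when $S$ sends $x$, the intermediate vertices apply $\mathcal F$ to the symbols they receive, and an adversary changes the symbols on at most $t$ edges, all belonging to $\mathcal U$. The one-shot capacity $\mathrm C_1(\mathcal N,\mathcal A,\mathcal U,t)$ is the largest value of $\log_{|\mathcal A|}|\mathcal C|$, where $\mathcal C$ ranges over the nonempty sets of words on the outgoing edges of $S$ for which there is a network code $\mathcal F$ such that $\Omega_{\mathcal F,T}(x)\cap\Omega_{\mathcal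 F,T}(x')=\emptyset$ for all distinct $x,x'\in\mathcal C$ and all terminals $T$. Let $\mathfrak S_{3,1,2}=([3,3],[3,2])$ be the network with the source $S$, two intermediate vertices $V_1,V_2$ and a single terminal $T$, whose edges are three edges from $S$ to $V_1$, three edges from $S$ to $V_2$, three edges from $V_1$ to $T$ and two edges from $V_2$ to $T$. Let $\mathcal U_S$ be the set of the six outgoing edges of $S$. **Theorem.** 1. $\mathrm C_1(\mathfrak S_{3,1,2},\mathbb F_2,\mathcal U_S,1)=\log_2 6$. 2. $\log_3 15\le \mathrm C_1(\mathfrak S_{3,1,2},\mathbb F_3,\mathcal U_S,1)\le 3$. 3. $\mathrm C_1(\mathfrak S_{3,1,2},\mathcal A,\mathcal U_S,1)=3$ for every finite alphabet $\mathcal A$ with $|\mathcal A|\ge 4$. -/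

import Mathlib

/-- A single-source network: a finite, directed, acyclic multigraph with vertex type `V` and
edge type `E`, a distinguished source and a nonempty set of terminals. -/
structure Network (V E : Type) where
  finite_vertices : Finite V
  finite_edges : Finite E
  /-- the vertex that an edge leaves -/
  tail : E → V
  /-- the vertex that an edge enters -/
  head : E → V
  source : V
  terminals : Set V
  /-- there is no directed cycle -/
  acyclic : ∀ v : V, ¬ Relation.TransGen (fun u w => ∃ e, tail e = u ∧ head e = w) v v
  terminals_nonempty : terminals.Nonempty
  source_notMem : source ∉ terminals
  source_no_incoming : ∀ e, head e ≠ source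
  terminal_no_outgoing : ∀ e, tail e ∉ terminals
  path_to_terminal : ∀ T ∈ terminals,
    Relation.TransGen (fun u w => ∃ e, tail e = u ∧ head e = w) source T
  path_through : ∀ v, v ≠ source → v ∉ terminals →
    Relation.TransGen (fun u w => ∃ e, tail e = u ∧ head e = w) source v ∧
    ∃ T ∈ terminals, Relation.TransGen (fun u w => ∃ e, tail e = u ∧ head e = w) v T

namespace Network

variable {V E : Type}

/-- The incoming edges of a vertex. -/
abbrev In (N : Network V E) (v : V) : Type := {e : E // N.head e = v}

/-- The outgoing edges of a vertex. -/
abbrev Out (N : Network V E) (v : V) : Type := {e : E // N.tail e = v}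

/-- The intermediate vertices. -/
abbrev Intermediate (N : Network V E) : Type := {v : V // v ≠ N.source ∧ v ∉ N.terminals}

/-- The set of all outgoing edges of the source. -/
def sourceEdges (N : Network V E) : Set E := {e | N.tail e = N.source}

/-- A network code: every intermediate vertex gets a function from the words on its incoming
edges to the words on its outgoing edges. -/
abbrev Code (N : Network V E) (A : Type*) : Type _ :=
  (v : N.Intermediate) → (N.In v.1 → A) → (N.Out v.1 → A)

/-- The adversarial channel from the source to `T`: all words that can be seen on the incoming
edges of `T` when the source emits `x`, the intermediate vertices apply the network code, and an
adversary changes the symbols on at most `t` edges, all of them in `U`. Here `sent e` is the symbol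
that is put on the edge `e` by its tail, and `recv e` is the symbol that arrives at its head. -/
def channel (N : Network V E) {A : Type*} (F : N.Code A) (T : V) (U : Set E) (t : ℕ)
    (x : N.Out N.source → A) : Set (N.In T → A) :=
  {y | ∃ sent recv : E → A,
    (∀ e : N.Out N.source, sent e.1 = x e) ∧
    (∀ (v : N.Intermediate) (e : N.Out v.1), sent e.1 = F v (fun e' => recv e'.1) e) ∧
    {e | recv e ≠ sent e} ⊆ U ∧
    {e | recv e ≠ sent e}.ncard ≤ t ∧
    ∀ e : N.In T, y e = recv e.1}

/-- An outer code (a nonempty set of source words) is unambiguous for the channel to `T` if distinct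
codewords have disjoint sets of channel outputs. -/
def Unambiguous (N : Network V E) {A : Type*} (F : N.Code A) (T : V) (U : Set E) (t : ℕ)
    (C : Set (N.Out N.source → A)) : Prop :=
  C.Nonempty ∧ ∀ x ∈ C, ∀ x' ∈ C, x ≠ x' → Disjoint (N.channel F T U t x) (N.channel F T U t x')

/-- The values `log_{|A|} |C|`, where `C` is an outer code which, together with a suitable network
code, is unambiguous for the channels to all terminals. -/
def achievableRates (N : Network V E) (A : Type*) (U : Set E) (t : ℕ) : Set ℝ :=
  {γ | ∃ (F : N.Code A) (C : Set (N.Out N.source → A)),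
    (∀ T ∈ N.terminals, N.Unambiguous F T U t C) ∧
    γ = Real.logb (Nat.card A : ℝ) (C.ncard : ℝ)}

/-- `γ` is the one-shot capacity of `(N, A, U, t)`: the largest achievable rate. -/
def IsCapacity (N : Network V E) (A : Type*) (U : Set E) (t : ℕ) (γ : ℝ) : Prop :=
  IsGreatest (N.achievableRates A U t) γ

end Network

/-- The vertices of a simple 2-level network with two intermediate vertices `v₁` and `v₂`. -/
inductive TwoLevelVertex : Type
  | S
  | v₁
  | v₂
  | T

/-- The edges of a simple 2-level network: `m₁` edges from `S` to `v₁`, `m₂` edges from `S` to `v₂`,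
`n₁` edges from `v₁` to `T`, and `n₂` edges from `v₂` to `T`. -/
inductive TwoLevelEdge (m₁ m₂ n₁ n₂ : ℕ) : Type
  | sv₁ (i : Fin m₁)
  | sv₂ (i : Fin m₂)
  | v₁t (i : Fin n₁)
  | v₂t (i : Fin n₂)

namespace TwoLevelVertex

/-- The distance from the source. -/
def level : TwoLevelVertex → ℕ
  | S => 0
  | v₁ => 1
  | v₂ => 1
  | T => 2

theorem finite : Finite TwoLevelVertex := by
  refine Finite.of_surjective (fun i : Fin 4 => (![S, v₁, v₂, T] i : TwoLevelVertex)) ?_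
  intro v
  cases v
  · exact ⟨0, rfl⟩
  · exact ⟨1, rfl⟩
  · exact ⟨2, rfl⟩
  · exact ⟨3, rfl⟩

end TwoLevelVertex

namespace TwoLevelEdge

variable {m₁ m₂ n₁ n₂ : ℕ}

/-- The vertex that an edge leaves. -/
def tail : TwoLevelEdge m₁ m₂ n₁ n₂ → TwoLevelVertex
  | sv₁ _ => .S
  | sv₂ _ => .S
  | v₁t _ => .v₁
  | v₂t _ => .v₂

/-- The vertex that an edge enters. -/
def head : TwoLevelEdge m₁ m₂ n₁ n₂ → TwoLevelVertex
  | sv₁ _ => .v₁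
  | sv₂ _ => .v₂
  | v₁t _ => .T
  | v₂t _ => .T

theorem finite : Finite (TwoLevelEdge m₁ m₂ n₁ n₂) := by
  refine Finite.of_surjective
    (fun x : (Fin m₁ ⊕ Fin m₂) ⊕ (Fin n₁ ⊕ Fin n₂) =>
      (Sum.elim (Sum.elim sv₁ sv₂) (Sum.elim v₁t v₂t) x : TwoLevelEdge m₁ m₂ n₁ n₂)) ?_
  intro e
  cases e with
  | sv₁ i => exact ⟨.inl (.inl i), rfl⟩
  | sv₂ i => exact ⟨.inl (.inr i), rfl⟩
  | v₁t i => exact ⟨.inr (.inl i), rfl⟩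
  | v₂t i => exact ⟨.inr (.inr i), rfl⟩

theorem level_lt {u w : TwoLevelVertex}
    (h : Relation.TransGen
      (fun u w => ∃ e : TwoLevelEdge m₁ m₂ n₁ n₂, tail e = u ∧ head e = w) u w) :
    u.level < w.level := by
  have key : ∀ e : TwoLevelEdge m₁ m₂ n₁ n₂, (tail e).level < (head e).level := by
    intro e
    cases e <;> simp [tail, head, TwoLevelVertex.level]
  induction h with
  | single h => obtain ⟨e, rfl, rfl⟩ := h; exact key e
  | tail _ h ih => obtain ⟨e, rfl, rfl⟩ := h; exact ih.trans (key e)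

end TwoLevelEdge

/-- The simple 2-level network `([m₁, m₂], [n₁, n₂])` with two intermediate vertices: `mᵢ` and `nᵢ`
are the numbers of incoming and of outgoing edges of the `i`-th intermediate vertex. -/
def twoLevelNetwork (m₁ m₂ n₁ n₂ : ℕ) (hm₁ : 1 ≤ m₁) (hm₂ : 1 ≤ m₂) (hn₁ : 1 ≤ n₁) (hn₂ : 1 ≤ n₂) :
    Network TwoLevelVertex (TwoLevelEdge m₁ m₂ n₁ n₂) where
  finite_vertices := TwoLevelVertex.finite
  finite_edges := TwoLevelEdge.finite
  tail := TwoLevelEdge.tail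
  head := TwoLevelEdge.head
  source := .S
  terminals := {.T}
  acyclic := fun _ h => lt_irrefl _ (TwoLevelEdge.level_lt h)
  terminals_nonempty := ⟨_, rfl⟩
  source_notMem := by simp
  source_no_incoming := by intro e; cases e <;> simp [TwoLevelEdge.head]
  terminal_no_outgoing := by intro e; cases e <;> simp [TwoLevelEdge.tail]
  path_to_terminal := by
    rintro _ rfl
    exact (Relation.TransGen.single ⟨.sv₁ ⟨0, hm₁⟩, rfl, rfl⟩).tail ⟨.v₁t ⟨0, hn₁⟩, rfl, rfl⟩
  path_through := by
    intro v hS hT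
    cases v with
    | S => exact absurd rfl hS
    | v₁ => exact ⟨.single ⟨.sv₁ ⟨0, hm₁⟩, rfl, rfl⟩, _, rfl, .single ⟨.v₁t ⟨0, hn₁⟩, rfl, rfl⟩⟩
    | v₂ => exact ⟨.single ⟨.sv₂ ⟨0, hm₂⟩, rfl, rfl⟩, _, rfl, .single ⟨.v₂t ⟨0, hn₂⟩, rfl, rfl⟩⟩
    | T => exact absurd rfl hT

/-- The network `𝔖_{a,b,s} = ([a, b + s], [a, s])`. -/
def networkS (a b s : ℕ) (ha : 1 ≤ a) (hs : 1 ≤ s) :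
    Network TwoLevelVertex (TwoLevelEdge a (b + s) a s) :=
  twoLevelNetwork a (b + s) a s ha (hs.trans (Nat.le_add_left s b)) ha hs

/-- The network `𝔖_{3,1,2} = ([3, 3], [3, 2])`. -/
abbrev networkS312 : Network TwoLevelVertex (TwoLevelEdge 3 (1 + 2) 3 2) :=
  networkS 3 1 2 (by norm_num) (by norm_num)

/-! Since only source edges are attacked, the channel perturbs a pair `(p, s)` of words of length
three in at most one position in total and then applies the maps `f` and `g` of the two intermediate
vertices. Group the codewords by the class `g s`; there are `|A|²` classes.

Upper bounds: two codewords in one class must have first parts that differ in every position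
(`apply_ne_of_apply_eq`), so a class has at most `|A|` codewords and the code at most `|A|³`. Over
two symbols, seven codewords would force `g` to be constant, with distinct values, on three unit
balls of `F₂³`, but two of these balls always meet (`ncard_le_six`).

Lower bounds: `v₁` forwards its word. It remains to make the first parts in each class have distance
three, and to ensure that one error towards `v₂` never leads to the class of a codeword whose first
part is at distance at most one (`logb_mem_achievableRates_networkS312`). Explicit tables do this
for two and three symbols. For larger alphabets all `|A|³` first parts are used, with classes the
cosets of a repetition-like code. -/

/-! ### The adversarial channel of a simple 2-level network -/

section TwoLevel

variable {m₁ m₂ n₁ n₂ : ℕ} {hm₁ : 1 ≤ m₁} {hm₂ : 1 ≤ m₂} {hn₁ : 1 ≤ n₁} {hn₂ : 1 ≤ n₂}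
  {A : Type*}

local notation "𝒩" => twoLevelNetwork m₁ m₂ n₁ n₂ hm₁ hm₂ hn₁ hn₂

/-- The network code in which `v₁` applies `f` and `v₂` applies `g`. -/
def twoLevelCode (f : (Fin m₁ → A) → Fin n₁ → A) (g : (Fin m₂ → A) → Fin n₂ → A) :
    (𝒩).Code A := fun v w e =>
  match v, w, e with
  | ⟨.v₁, _⟩, w, ⟨.v₁t i, _⟩ => f (fun k => w ⟨.sv₁ k, rfl⟩) i
  | ⟨.v₂, _⟩, w, ⟨.v₂t i, _⟩ => g (fun k => w ⟨.sv₂ k, rfl⟩) i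
  | ⟨.S, h⟩, _, _ => absurd rfl h.1
  | ⟨.T, h⟩, _, _ => absurd rfl h.2

/-- The source word with the given restrictions to the edges towards `v₁` and `v₂`. -/
def twoLevelWord (p : Fin m₁ → A) (s : Fin m₂ → A) : (𝒩).Out (𝒩).source → A := fun e =>
  match e with
  | ⟨.sv₁ i, _⟩ => p i
  | ⟨.sv₂ i, _⟩ => s i

theorem exists_eq_twoLevelCode (F : (𝒩).Code A) : ∃ f g, F = twoLevelCode f g := by
  refine ⟨fun w i => F ⟨.v₁, nofun, nofun⟩
      (fun e => match e with | ⟨.sv₁ k, _⟩ => w k) ⟨.v₁t i, rfl⟩,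
    fun w i => F ⟨.v₂, nofun, nofun⟩
      (fun e => match e with | ⟨.sv₂ k, _⟩ => w k) ⟨.v₂t i, rfl⟩, ?_⟩
  funext v w e
  rcases v with ⟨_ | _ | _ | _, h⟩
  · exact absurd rfl h.1
  · rcases e with ⟨_ | _ | i | _, he⟩ <;> try cases he
    simp only [twoLevelCode]
    congr 1
    funext e
    rcases e with ⟨k | _ | _ | _, he⟩ <;> first | rfl | cases he
  · rcases e with ⟨_ | _ | _ | i, he⟩ <;> try cases he
    simp only [twoLevelCode]
    congr 1
    funext e
    rcases e with ⟨_ | k | _ | _, he⟩ <;> first | rfl | cases he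
  · exact absurd rfl h.2

theorem exists_eq_twoLevelWord (x : (𝒩).Out (𝒩).source → A) : ∃ p s, x = twoLevelWord p s := by
  refine ⟨fun i => x ⟨.sv₁ i, rfl⟩, fun i => x ⟨.sv₂ i, rfl⟩, ?_⟩
  funext e
  rcases e with ⟨_ | _ | _ | _, he⟩ <;> first | rfl | cases he

theorem twoLevelWord_inj {p p' : Fin m₁ → A} {s s' : Fin m₂ → A} :
    (twoLevelWord p s : (𝒩).Out (𝒩).source → A) = twoLevelWord p' s' ↔ p = p' ∧ s = s' := by
  refine ⟨fun h => ⟨funext fun i => congrFun h ⟨.sv₁ i, rfl⟩,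
    funext fun i => congrFun h ⟨.sv₂ i, rfl⟩⟩, ?_⟩
  rintro ⟨rfl, rfl⟩
  rfl

-- Edges into `T` are safe from the adversary, so the number of attacked edges is the sum of the
-- Hamming distances at `v₁` and `v₂`.
open TwoLevelEdge in
theorem mem_channel_twoLevel [DecidableEq A] {f : (Fin m₁ → A) → Fin n₁ → A}
    {g : (Fin m₂ → A) → Fin n₂ → A} {t : ℕ} {p : Fin m₁ → A} {s : Fin m₂ → A}
    {y : (𝒩).In .T → A} :
    y ∈ (𝒩).channel (twoLevelCode f g) .T (𝒩).sourceEdges t (twoLevelWord p s) ↔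
      ∃ p' s', hammingDist p' p + hammingDist s' s ≤ t ∧
        (∀ i, y ⟨v₁t i, rfl⟩ = f p' i) ∧ ∀ i, y ⟨v₂t i, rfl⟩ = g s' i := by
  have count (sent recv : TwoLevelEdge m₁ m₂ n₁ n₂ → A)
      (h : {e | recv e ≠ sent e} ⊆ (𝒩).sourceEdges) :
      {e | recv e ≠ sent e}.ncard = hammingDist (fun i => recv (sv₁ i)) (fun i => sent (sv₁ i)) +
        hammingDist (fun i => recv (sv₂ i)) (fun i => sent (sv₂ i)) := by
    have hset : {e | recv e ≠ sent e} =
        sv₁ '' {i | recv (sv₁ i) ≠ sent (sv₁ i)} ∪ sv₂ '' {i | recv (sv₂ i) ≠ sent (sv₂ i)} := by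
      ext e
      constructor
      · intro he
        have := h he
        cases e with
        | sv₁ i => exact Or.inl ⟨i, he, rfl⟩
        | sv₂ i => exact Or.inr ⟨i, he, rfl⟩
        | v₁t i => cases this
        | v₂t i => cases this
      · rintro (⟨i, hi, rfl⟩ | ⟨i, hi, rfl⟩) <;> exact hi
    rw [hset, Set.ncard_union_eq, Set.ncard_image_of_injective, Set.ncard_image_of_injective]
    · simp [hammingDist, Set.ncard_eq_toFinset_card']
    · intro i j hij; injection hij
    · intro i j hij; injection hij
    · rw [Set.disjoint_left]
      rintro _ ⟨i, _, rfl⟩ ⟨j, _, h⟩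
      cases h
  constructor
  · rintro ⟨sent, recv, h1, h2, h3, h4, h5⟩
    rw [count sent recv h3] at h4
    have e1 : (fun i => sent (sv₁ i)) = p := funext fun i => h1 ⟨sv₁ i, rfl⟩
    have e2 : (fun i => sent (sv₂ i)) = s := funext fun i => h1 ⟨sv₂ i, rfl⟩
    have hr (e : TwoLevelEdge m₁ m₂ n₁ n₂) (he : tail e ≠ .S) : recv e = sent e := by
      by_contra hne
      exact he (h3 hne)
    rw [e1, e2] at h4
    refine ⟨_, _, h4, fun i => ?_, fun i => ?_⟩
    · rw [h5, hr _ (by rintro ⟨⟩)]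
      exact h2 ⟨.v₁, nofun, nofun⟩ ⟨v₁t i, rfl⟩
    · rw [h5, hr _ (by rintro ⟨⟩)]
      exact h2 ⟨.v₂, nofun, nofun⟩ ⟨v₂t i, rfl⟩
  · rintro ⟨p', s', h, h1, h2⟩
    let sent : TwoLevelEdge m₁ m₂ n₁ n₂ → A := fun e =>
      match e with
      | sv₁ i => p i
      | sv₂ i => s i
      | v₁t i => f p' i
      | v₂t i => g s' i
    let recv : TwoLevelEdge m₁ m₂ n₁ n₂ → A := fun e =>
      match e with
      | sv₁ i => p' i
      | sv₂ i => s' i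
      | v₁t i => f p' i
      | v₂t i => g s' i
    have hsub : {e | recv e ≠ sent e} ⊆ (𝒩).sourceEdges := by
      intro e he
      cases e with
      | sv₁ i => rfl
      | sv₂ i => rfl
      | v₁t i => exact absurd rfl he
      | v₂t i => exact absurd rfl he
    refine ⟨sent, recv, ?_, ?_, hsub, (count sent recv hsub).trans_le h, ?_⟩
    · rintro ⟨_ | _ | _ | _, he⟩ <;> first | rfl | cases he
    · rintro ⟨_ | _ | _ | _, hv⟩ ⟨_ | _ | _ | _, he⟩ <;>
        first | exact absurd rfl hv.1 | exact absurd rfl hv.2 | rfl | cases he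
    · rintro ⟨_ | _ | _ | _, he⟩ <;> first | exact h1 _ | exact h2 _ | cases he

theorem logb_mem_achievableRates_twoLevel [DecidableEq A] {ι : Type*} [Nonempty ι]
    (f : (Fin m₁ → A) → Fin n₁ → A) (g : (Fin m₂ → A) → Fin n₂ → A) (t : ℕ)
    (p : ι → Fin m₁ → A) (s : ι → Fin m₂ → A)
    (hp : Function.Injective p)
    (h : ∀ i j, i ≠ j → ∀ a b a' b', hammingDist a (p i) + hammingDist b (s i) ≤ t →
      hammingDist a' (p j) + hammingDist b' (s j) ≤ t → f a = f a' → g b ≠ g b') :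
    Real.logb (Nat.card A) (Nat.card ι) ∈ (𝒩).achievableRates A (𝒩).sourceEdges t := by
  have hinj : Function.Injective
      (fun i => (twoLevelWord (p i) (s i) : (𝒩).Out (𝒩).source → A)) :=
    fun i j hij => hp (twoLevelWord_inj.1 hij).1
  refine ⟨twoLevelCode f g, Set.range fun i => twoLevelWord (p i) (s i), ?_, ?_⟩
  · rintro _ rfl
    refine ⟨Set.range_nonempty _, ?_⟩
    rintro _ ⟨i, rfl⟩ _ ⟨j, rfl⟩ hij
    rw [Set.disjoint_left]
    intro y hy hy'
    obtain ⟨a, b, hab, h1, h2⟩ := mem_channel_twoLevel.1 hy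
    obtain ⟨a', b', hab', h1', h2'⟩ := mem_channel_twoLevel.1 hy'
    exact h i j (fun e => hij (by rw [e])) a b a' b' hab hab'
      (funext fun k => (h1 k).symm.trans (h1' k)) (funext fun k => (h2 k).symm.trans (h2' k))
  · rw [← Set.image_univ, Set.ncard_image_of_injective _ hinj, Set.ncard_univ]

theorem exists_code_of_mem_achievableRates_twoLevel [DecidableEq A] {t : ℕ} {γ : ℝ}
    (hγ : γ ∈ (𝒩).achievableRates A (𝒩).sourceEdges t) :
    ∃ (f : (Fin m₁ → A) → Fin n₁ → A) (g : (Fin m₂ → A) → Fin n₂ → A)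
      (C : Set ((Fin m₁ → A) × (Fin m₂ → A))), C.Nonempty ∧
      (∀ x ∈ C, ∀ x' ∈ C, x ≠ x' → ∀ a b a' b',
        hammingDist a x.1 + hammingDist b x.2 ≤ t →
        hammingDist a' x'.1 + hammingDist b' x'.2 ≤ t → f a = f a' → g b ≠ g b') ∧
      γ = Real.logb (Nat.card A) C.ncard := by
  obtain ⟨F, C, hC, rfl⟩ := hγ
  obtain ⟨hne, hdis⟩ := hC .T rfl
  obtain ⟨f, g, rfl⟩ := exists_eq_twoLevelCode F
  let φ : (Fin m₁ → A) × (Fin m₂ → A) → ((𝒩).Out (𝒩).source → A) :=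
    fun x => twoLevelWord x.1 x.2
  have hφ : Function.Injective φ := fun x y h => Prod.ext_iff.2 (twoLevelWord_inj.1 h)
  have hs : C ⊆ Set.range φ := fun x _ => by
    obtain ⟨p, s, rfl⟩ := exists_eq_twoLevelWord x
    exact ⟨(p, s), rfl⟩
  refine ⟨f, g, φ ⁻¹' C, ?_, ?_, ?_⟩
  · obtain ⟨x, hx⟩ := hne
    obtain ⟨z, rfl⟩ := hs hx
    exact ⟨z, hx⟩
  · intro x hx x' hx' hxx' a b a' b' h h' hf hg
    refine (Set.disjoint_left.1 (hdis _ hx _ hx' (hφ.ne hxx')))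
      (a := fun e => match e with
        | ⟨.v₁t i, _⟩ => f a i
        | ⟨.v₂t i, _⟩ => g b i)
      (mem_channel_twoLevel.2 ⟨a, b, h, fun _ => rfl, fun _ => rfl⟩)
      (mem_channel_twoLevel.2 ⟨a', b', h', fun i => congrFun hf i, fun i => congrFun hg i⟩)
  · rw [Set.ncard_preimage_of_injective_subset_range hφ hs]

end TwoLevel

/-! ### Codes on pairs of words of length three -/

theorem exists_update_of_hammingDist_le_one {n : ℕ} {A : Type*} [DecidableEq A] [NeZero n]
    {x y : Fin n → A} (h : hammingDist x y ≤ 1) : ∃ k a, x = Function.update y k a := by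
  rcases Nat.le_one_iff_eq_zero_or_eq_one.1 h with h | h
  · rw [hammingDist_eq_zero] at h
    exact ⟨0, y 0, by rw [h, Function.update_eq_self]⟩
  · obtain ⟨k, hk⟩ := Finset.card_eq_one.1 h
    refine ⟨k, x k, funext fun l => ?_⟩
    by_cases hl : l = k
    · rw [hl, Function.update_self]
    · rw [Function.update_of_ne hl]
      by_contra hne
      exact hl (Finset.mem_singleton.1 (hk ▸ Finset.mem_filter.2 ⟨Finset.mem_univ _, hne⟩))

theorem three_le_hammingDist {A : Type*} [DecidableEq A] {x y : Fin 3 → A}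
    (h : ∀ k, x k ≠ y k) : 3 ≤ hammingDist x y := by
  simp [hammingDist, h]

/-- If `v₁` forwards its input, `v₂` applies `g`, and each codeword is determined by its part `p i`
sent to `v₁`, then it suffices to check two conditions on pairs of codewords. -/
theorem logb_mem_achievableRates_networkS312 {A : Type*} [DecidableEq A] {ι : Type*} [Nonempty ι]
    (p s : ι → Fin 3 → A) (g : (Fin 3 → A) → Fin 2 → A) (hp : Function.Injective p)
    (h₃ : ∀ i j, i ≠ j → g (s i) = g (s j) → 3 ≤ hammingDist (p i) (p j))
    (h₁ : ∀ i j, i ≠ j → hammingDist (p i) (p j) ≤ 1 →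
      ∀ k a, g (Function.update (s i) k a) ≠ g (s j)) :
    Real.logb (Nat.card A) (Nat.card ι) ∈
      networkS312.achievableRates A networkS312.sourceEdges 1 := by
  refine logb_mem_achievableRates_twoLevel (m₁ := 3) (n₁ := 3) id g 1 p s hp ?_
  rintro i j hij a b a' b' h h' rfl hg
  simp only [id] at h'
  have tri := hammingDist_triangle_left (p i) (p j) a
  by_cases hb : hammingDist b (s i) = 0
  · rw [hammingDist_eq_zero] at hb
    subst hb
    by_cases hb' : hammingDist b' (s j) = 0
    · rw [hammingDist_eq_zero] at hb'
      subst hb'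
      have := h₃ i j hij hg
      omega
    · obtain ⟨k, c, rfl⟩ := exists_update_of_hammingDist_le_one (x := b') (y := s j) (by omega)
      exact h₁ j i hij.symm (by rw [hammingDist_comm]; omega) k c hg.symm
  · by_cases hb' : hammingDist b' (s j) = 0
    · rw [hammingDist_eq_zero] at hb'
      subst hb'
      obtain ⟨k, c, rfl⟩ := exists_update_of_hammingDist_le_one (x := b) (y := s i) (by omega)
      exact h₁ i j hij (by omega) k c hg
    · refine hij (hp (hammingDist_eq_zero.1 ?_))
      omega

/-! ### Explicit codes over two and three symbols -/

/-- All words sent to `v₂` have odd weight, and `g` maps every even word to `(0, 1)`, which thus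
signals an error at `v₂`. Each of the other three values carries a complementary pair of first
parts. -/
theorem logb_six_mem_achievableRates :
    Real.logb 2 6 ∈ networkS312.achievableRates (ZMod 2) networkS312.sourceEdges 1 := by
  have := logb_mem_achievableRates_networkS312 (A := ZMod 2) (ι := Fin 6)
    ![![0, 0, 1], ![1, 1, 1], ![0, 1, 1], ![1, 0, 0], ![1, 1, 0], ![0, 0, 0]]
    ![![1, 1, 1], ![1, 0, 0], ![0, 0, 1], ![0, 0, 1], ![0, 1, 0], ![1, 0, 0]]
    (fun y => ![![![![0, 1], ![0, 0]], ![![1, 0], ![0, 1]]],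
      ![![![1, 1], ![0, 1]], ![![0, 1], ![1, 0]]]] (y 0) (y 1) (y 2))
    (by decide +kernel) (by decide +kernel) (by decide +kernel)
  simpa using this

/-- Here no value of `g` is reserved for errors: one class has three codewords, four have two and
four have one. -/
theorem logb_fifteen_mem_achievableRates :
    Real.logb 3 15 ∈ networkS312.achievableRates (ZMod 3) networkS312.sourceEdges 1 := by
  have := logb_mem_achievableRates_networkS312 (A := ZMod 3) (ι := Fin 15)
    ![![1, 1, 0], ![2, 1, 1], ![1, 1, 2], ![2, 2, 2], ![2, 2, 1], ![0, 1, 0], ![1, 2, 2],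
      ![0, 2, 1], ![0, 0, 0], ![1, 0, 1], ![1, 2, 0], ![2, 0, 2], ![0, 1, 1], ![0, 2, 2],
      ![2, 0, 0]]
    ![![2, 0, 2], ![0, 0, 1], ![0, 2, 1], ![1, 2, 0], ![2, 0, 2], ![1, 2, 0], ![0, 1, 2],
      ![0, 2, 1], ![0, 2, 2], ![1, 2, 0], ![0, 0, 1], ![2, 2, 2], ![0, 1, 2], ![1, 1, 1],
      ![1, 2, 1]]
    (fun y => ![
      ![![![2, 1], ![1, 1], ![0, 2]], ![![0, 2], ![2, 2], ![1, 2]], ![![1, 1], ![1, 0], ![2, 1]]],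
      ![![![0, 0], ![2, 2], ![2, 1]], ![![2, 2], ![0, 1], ![0, 2]], ![![0, 0], ![2, 2], ![1, 1]]],
      ![![![0, 2], ![0, 1], ![2, 0]], ![![0, 1], ![2, 0], ![0, 2]], ![![1, 1], ![1, 0], ![0, 2]]]]
      (y 0) (y 1) (y 2))
    (by decide +kernel) (by decide +kernel) (by decide +kernel)
  simpa using this

/-! ### Codes of rate three over at least four symbols -/

/-- Two words of length three at distance at most one agree in two of their coordinates. -/
theorem eq_and_eq_of_hammingDist_le_one {A : Type*} [DecidableEq A] {x y : Fin 3 → A}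
    (h : hammingDist x y ≤ 1) :
    x 0 = y 0 ∧ x 1 = y 1 ∨ x 0 = y 0 ∧ x 2 = y 2 ∨ x 1 = y 1 ∧ x 2 = y 2 := by
  obtain ⟨k, a, rfl⟩ := exists_update_of_hammingDist_le_one h
  fin_cases k <;> simp

/-- The classes are the cosets of the diagonal, labelled by `(x 1 - x 0, x 2 - x 0)`. Changing one
symbol of `x` moves the label by `(e, 0)`, `(0, e)` or `(e, e)`. The vertex `v₂` receives the label
with a check symbol; when the check fails by `δ`, it adds `c δ`, chosen so that every single error
moves the label by some `d` with nonzero, distinct entries. -/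
theorem logb_card_pow_three_mem_achievableRates_of_addCommGroup {A : Type*} [Finite A]
    [AddCommGroup A] (hA : 5 ≤ Nat.card A) :
    Real.logb (Nat.card A) (Nat.card (Fin 3 → A)) ∈
      networkS312.achievableRates A networkS312.sourceEdges 1 := by
  classical
  have := Fintype.ofFinite A
  have avoid (S : Finset A) (hS : S.card ≤ 4) : ∃ v, v ∉ S := by
    by_contra! h
    have := Finset.card_le_card (fun a _ => h a : (Finset.univ : Finset A) ⊆ S)
    rw [Finset.card_univ, ← Nat.card_eq_fintype_card] at this
    omega
  -- the correction that `v₂` applies to a word outside of its main code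
  have key (δ : A) (hδ : δ ≠ 0) : ∃ c : A × A, c.1 ≠ 0 ∧ c.1 ≠ δ ∧ c.2 ≠ 0 ∧ c.2 ≠ δ ∧
      c.2 ≠ c.1 ∧ c.2 ≠ c.1 + δ ∧ c.2 ≠ c.1 - δ := by
    -- In either case two of the constraints on the second entry coincide, so only four values are
    -- forbidden and five symbols suffice.
    by_cases h2 : δ + δ = 0
    · obtain ⟨u, hu⟩ := avoid {0, δ} (Finset.card_le_two.trans (by norm_num))
      obtain ⟨v, hv⟩ := avoid {0, δ, u, u + δ} Finset.card_le_four
      simp only [Finset.mem_insert, Finset.mem_singleton, not_or] at hu hv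
      have : u - δ = u + δ := by rw [sub_eq_iff_eq_add, add_assoc, h2, add_zero]
      exact ⟨(u, v), hu.1, hu.2, hv.1, hv.2.1, hv.2.2.1, hv.2.2.2, this ▸ hv.2.2.2⟩
    · obtain ⟨v, hv⟩ := avoid {0, δ, δ + δ, δ + δ + δ} Finset.card_le_four
      simp only [Finset.mem_insert, Finset.mem_singleton, not_or] at hv
      exact ⟨(δ + δ, v), h2, by simpa using hδ, hv.1, hv.2.1, hv.2.2.1, hv.2.2.2,
        by simpa using hv.2.1⟩
  choose! c hc using key
  let g : (Fin 3 → A) → Fin 2 → A := fun y =>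
    if y 2 = y 0 + y 1 then ![y 0, y 1]
    else ![y 0 + (c (y 2 - y 0 - y 1)).1, y 1 + (c (y 2 - y 0 - y 1)).2]
  let s : (Fin 3 → A) → Fin 3 → A := fun x =>
    ![x 1 - x 0, x 2 - x 0, (x 1 - x 0) + (x 2 - x 0)]
  have hs (x : Fin 3 → A) : g (s x) = ![x 1 - x 0, x 2 - x 0] := by simp [g, s]
  -- symbol errors towards `v₂` do not lead to the class of a neighbouring codeword
  have hup (x : Fin 3 → A) (k : Fin 3) (a : A) : g (Function.update (s x) k a) = g (s x) ∨
      ∃ d : A × A, d.1 ≠ 0 ∧ d.2 ≠ 0 ∧ d.1 ≠ d.2 ∧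
        g (Function.update (s x) k a) = ![x 1 - x 0 + d.1, x 2 - x 0 + d.2] := by
    by_cases hk : a = s x k
    · left
      rw [hk, Function.update_eq_self]
    right
    fin_cases k
    · have hδ : x 1 - x 0 - a ≠ 0 := by
        rw [sub_ne_zero]
        exact Ne.symm hk
      have hne : ¬ s x 2 = a + s x 1 := by
        intro h
        apply hδ
        simp only [s, Matrix.cons_val] at h
        rw [sub_eq_zero]
        exact add_right_cancel h
      have hy : s x 2 - a - s x 1 = x 1 - x 0 - a := by
        simp only [s, Matrix.cons_val]
        abel
      obtain ⟨h1, h2, h3, h4, h5, h6, h7⟩ := hc _ hδ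
      refine ⟨((c (x 1 - x 0 - a)).1 - (x 1 - x 0 - a), (c (x 1 - x 0 - a)).2),
        sub_ne_zero.2 h2, h3, h7.symm, ?_⟩
      simp only [g, Fin.zero_eta, Function.update_self, ne_eq, Fin.reduceEq, not_false_eq_true,
        Function.update_of_ne, if_neg hne, hy]
      congr 1
      · abel
    · have hδ : x 2 - x 0 - a ≠ 0 := by
        rw [sub_ne_zero]
        exact Ne.symm hk
      have hne : ¬ s x 2 = s x 0 + a := by
        intro h
        apply hδ
        simp only [s, Matrix.cons_val] at h
        rw [sub_eq_zero]
        exact add_left_cancel h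
      have hy : s x 2 - s x 0 - a = x 2 - x 0 - a := by
        simp only [s, Matrix.cons_val]
        abel
      obtain ⟨h1, h2, h3, h4, h5, h6, h7⟩ := hc _ hδ
      refine ⟨((c (x 2 - x 0 - a)).1, (c (x 2 - x 0 - a)).2 - (x 2 - x 0 - a)),
        h1, sub_ne_zero.2 h4, fun h => h6 ?_, ?_⟩
      · simp only at h
        rw [h, sub_add_cancel]
      simp only [g, Fin.mk_one, Function.update_self, ne_eq, Fin.reduceEq, not_false_eq_true,
        Function.update_of_ne, if_neg hne, hy]
      congr 2
      abel
    · have hne : ¬ a = s x 0 + s x 1 := hk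
      have hδ : a - s x 0 - s x 1 ≠ 0 := by
        rw [sub_sub, sub_ne_zero]
        exact hne
      obtain ⟨h1, h2, h3, h4, h5, h6, h7⟩ := hc _ hδ
      refine ⟨c (a - s x 0 - s x 1), h1, h3, h5.symm, ?_⟩
      simp only [g, Fin.reduceFinMk, Function.update_self, ne_eq, Fin.reduceEq, not_false_eq_true,
        Function.update_of_ne, if_neg hne]
      rfl
  refine logb_mem_achievableRates_networkS312 id s g Function.injective_id ?_ ?_
  · intro x y hxy h
    rw [hs, hs] at h
    have h0 : x 1 - x 0 = y 1 - y 0 := congrFun h 0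
    have h1 : x 2 - x 0 = y 2 - y 0 := congrFun h 1
    rw [sub_eq_sub_iff_sub_eq_sub] at h0 h1
    have hk (k : Fin 3) : x k - y k = x 0 - y 0 := by fin_cases k <;> simp [h0, h1]
    refine three_le_hammingDist fun k hxk => hxy (funext fun l => ?_)
    rw [← sub_eq_zero, hk l, ← hk k]
    exact sub_eq_zero.2 hxk
  · intro x y hxy h k a hg
    rw [hs] at hg
    obtain ⟨d, hd1, hd2, hd⟩ : ∃ d : A × A, (d.1 = 0 ∧ d.2 = 0 ∨
        d.1 ≠ 0 ∧ d.2 ≠ 0 ∧ d.1 ≠ d.2) ∧ x 1 - x 0 + d.1 = y 1 - y 0 ∧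
        x 2 - x 0 + d.2 = y 2 - y 0 := by
      rcases hup x k a with h | ⟨d, h1, h2, h3, h4⟩
      · rw [h, hs] at hg
        exact ⟨0, Or.inl ⟨rfl, rfl⟩, by simpa using congrFun hg 0, by simpa using congrFun hg 1⟩
      · rw [h4] at hg
        exact ⟨d, Or.inr ⟨h1, h2, h3⟩, congrFun hg 0, congrFun hg 1⟩
    -- If only one symbol differs between `x` and `y`, this shift has a zero entry or equal entries,
    -- which leaves only `d = 0` and hence `x = y`.
    have e1 : d.1 = (y 1 - x 1) - (y 0 - x 0) := by rw [eq_sub_of_add_eq' hd2]; abel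
    have e2 : d.2 = (y 2 - x 2) - (y 0 - x 0) := by rw [eq_sub_of_add_eq' hd]; abel
    rw [e1, e2] at hd1
    refine hxy ?_
    rcases eq_and_eq_of_hammingDist_le_one h with ⟨h1, h2⟩ | ⟨h1, h2⟩ | ⟨h1, h2⟩ <;>
      simp only [id] at h1 h2 <;> rw [h1, h2] at hd1 <;>
      simp [sub_eq_zero] at hd1 <;>
      (funext l; fin_cases l <;> simp_all)

/-- The classes are the cosets of the line spanned by `(ω, -(1 + ω), 1)`, which has no zero entry.
Both label functionals have only nonzero coefficients, so either one separates words that differ in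
exactly one symbol, and one error towards `v₂` spoils at most one of them. -/
theorem logb_card_pow_three_mem_achievableRates_of_field {K : Type*} [Finite K] [Field K]
    (hK : 4 ≤ Nat.card K) :
    Real.logb (Nat.card K) (Nat.card (Fin 3 → K)) ∈
      networkS312.achievableRates K networkS312.sourceEdges 1 := by
  classical
  have := Fintype.ofFinite K
  obtain ⟨ω, hω⟩ : ∃ ω : K, ω ∉ ({0, 1, -1} : Finset K) := by
    by_contra! h
    have := Finset.card_le_card (fun a _ => h a : (Finset.univ : Finset K) ⊆ {0, 1, -1})
    rw [Finset.card_univ, ← Nat.card_eq_fintype_card] at this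
    have := Finset.card_le_three (a := (0 : K)) (b := 1) (c := -1)
    omega
  simp only [Finset.mem_insert, Finset.mem_singleton, not_or] at hω
  obtain ⟨h0, h1, h2⟩ := hω
  have h1 : 1 - ω ≠ 0 := sub_ne_zero.2 (Ne.symm h1)
  have h2 : 1 + ω ≠ 0 := fun h => h2 (by linear_combination h)
  refine logb_mem_achievableRates_networkS312 id
    (fun x => ![x 0 + x 1 + x 2, x 0 + ω * x 1 + ω ^ 2 * x 2, 0]) (fun y => ![y 0, y 1])
    Function.injective_id ?_ ?_
  · intro x y hxy h
    have e0 : x 0 + x 1 + x 2 = y 0 + y 1 + y 2 := congrFun h 0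
    have e1 : x 0 + ω * x 1 + ω ^ 2 * x 2 = y 0 + ω * y 1 + ω ^ 2 * y 2 := congrFun h 1
    have f1 : x 1 - y 1 = -(1 + ω) * (x 2 - y 2) := by
      refine mul_left_cancel₀ h1 ?_
      linear_combination e0 - e1
    have f0 : x 0 - y 0 = ω * (x 2 - y 2) := by
      linear_combination e0 - f1
    refine three_le_hammingDist fun k hk => hxy ?_
    have h22 : x 2 - y 2 = 0 := by
      fin_cases k
      · exact (mul_eq_zero.1 (f0.symm.trans (sub_eq_zero.2 hk))).resolve_left h0
      · exact (mul_eq_zero.1 (f1.symm.trans (sub_eq_zero.2 hk))).resolve_left (neg_ne_zero.2 h2)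
      · exact sub_eq_zero.2 hk
    rw [h22, mul_zero] at f0 f1
    funext l
    fin_cases l
    · exact sub_eq_zero.1 f0
    · exact sub_eq_zero.1 f1
    · exact sub_eq_zero.1 h22
  · intro x y hxy h k a hg
    have hor : x 0 + x 1 + x 2 = y 0 + y 1 + y 2 ∨
        x 0 + ω * x 1 + ω ^ 2 * x 2 = y 0 + ω * y 1 + ω ^ 2 * y 2 := by
      by_cases hk : k = 0
      · subst hk
        exact Or.inr (by simpa using congrFun hg 1)
      · exact Or.inl (by simpa [Function.update_of_ne (Ne.symm hk)] using congrFun hg 0)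
    refine hxy ?_
    rcases eq_and_eq_of_hammingDist_le_one h with ⟨e1, e2⟩ | ⟨e1, e2⟩ | ⟨e1, e2⟩ <;>
      simp only [id] at e1 e2 <;> rw [e1, e2] at hor <;>
      simp [h0] at hor <;>
      (funext l; fin_cases l <;> simp_all)

/-- The group construction needs five symbols; four symbols carry a field structure. -/
theorem three_mem_achievableRates {A : Type*} [Finite A] (hA : 4 ≤ Nat.card A) :
    (3 : ℝ) ∈ networkS312.achievableRates A networkS312.sourceEdges 1 := by
  have h3 : Real.logb (Nat.card A) (Nat.card (Fin 3 → A)) = 3 := by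
    rw [Nat.card_fun, Nat.card_fin, Nat.cast_pow, Real.logb_pow, Real.logb_self_eq_one]
    · norm_num
    · exact_mod_cast (show 1 < Nat.card A by omega)
  rw [← h3]
  have := Fintype.ofFinite A
  rcases hA.eq_or_lt with h | h
  · obtain ⟨_⟩ : Nonempty (Field A) := by
      rw [Fintype.nonempty_field_iff, ← Nat.card_eq_fintype_card, ← h]
      exact (Nat.prime_two.isPrimePow.pow (k := 2) two_ne_zero)
    exact logb_card_pow_three_mem_achievableRates_of_field hA
  · have : NeZero (Nat.card A) := ⟨by omega⟩
    let _ : AddCommGroup A := ((Finite.equivFin A).trans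
      (ZMod.finEquiv (Nat.card A)).toEquiv).addCommGroup
    exact logb_card_pow_three_mem_achievableRates_of_addCommGroup h

/-! ### Upper bounds -/

theorem hammingDist_update_le_one {n : ℕ} {A : Type*} [DecidableEq A] (x : Fin n → A) (k : Fin n)
    (a : A) : hammingDist (Function.update x k a) x ≤ 1 := by
  refine (Finset.card_le_card (t := {k}) fun l hl => ?_).trans_eq (Finset.card_singleton k)
  by_contra hlk
  exact (Finset.mem_filter.1 hl).2 (Function.update_of_ne (by simpa using hlk) _ _)

/-- Besides the shared symbol, `z` takes one symbol from each word; indices are modulo three. -/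
theorem exists_hammingDist_le_one_of_eq {A : Type*} [DecidableEq A] {x y : Fin 3 → A} {k : Fin 3}
    (h : x k = y k) : ∃ z, hammingDist z x ≤ 1 ∧ hammingDist z y ≤ 1 := by
  refine ⟨Function.update x (k + 1) (y (k + 1)), hammingDist_update_le_one .., ?_⟩
  have : Function.update x (k + 1) (y (k + 1)) = Function.update y (k + 2) (x (k + 2)) := by
    funext l
    fin_cases k <;> fin_cases l <;> simp_all [Function.update]
  rw [this]
  exact hammingDist_update_le_one ..

section UpperBound

variable {A : Type*} [DecidableEq A] {f : (Fin 3 → A) → Fin 3 → A}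
  {g : (Fin 3 → A) → Fin 2 → A} {C : Set ((Fin 3 → A) × (Fin 3 → A))}

theorem apply_ne_of_apply_eq
    (hC : ∀ x ∈ C, ∀ x' ∈ C, x ≠ x' → ∀ a b a' b',
      hammingDist a x.1 + hammingDist b x.2 ≤ 1 →
      hammingDist a' x'.1 + hammingDist b' x'.2 ≤ 1 → f a = f a' → g b ≠ g b')
    {x x' : (Fin 3 → A) × (Fin 3 → A)} (hx : x ∈ C) (hx' : x' ∈ C) (hne : x ≠ x')
    (hg : g x.2 = g x'.2) (k : Fin 3) : x.1 k ≠ x'.1 k := by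
  intro h
  obtain ⟨z, h1, h2⟩ := exists_hammingDist_le_one_of_eq h
  exact hC x hx x' hx' hne z x.2 z x'.2 (by simpa using h1) (by simpa using h2) rfl hg

/-- A codeword is determined by its class and the first symbol of its first part. -/
theorem ncard_le_card_pow_three [Finite A]
    (hC : ∀ x ∈ C, ∀ x' ∈ C, x ≠ x' → ∀ a b a' b',
      hammingDist a x.1 + hammingDist b x.2 ≤ 1 →
      hammingDist a' x'.1 + hammingDist b' x'.2 ≤ 1 → f a = f a' → g b ≠ g b') :
    C.ncard ≤ Nat.card A ^ 3 := by
  have hinj : Set.InjOn (fun x : (Fin 3 → A) × (Fin 3 → A) => (x.1 0, g x.2)) C := by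
    intro x hx x' hx' h
    by_contra hne
    obtain ⟨h1, h2⟩ := Prod.ext_iff.1 h
    exact apply_ne_of_apply_eq hC hx hx' hne h2 0 h1
  have := Set.ncard_le_card ((fun x : (Fin 3 → A) × (Fin 3 → A) => (x.1 0, g x.2)) '' C)
  rw [hinj.ncard_image, Nat.card_prod, Nat.card_fun, Nat.card_fin] at this
  exact this.trans_eq (by ring)

end UpperBound

theorem le_three_of_mem_achievableRates {A : Type*} [Finite A] (hA : 2 ≤ Nat.card A) {γ : ℝ}
    (hγ : γ ∈ networkS312.achievableRates A networkS312.sourceEdges 1) : γ ≤ 3 := by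
  classical
  obtain ⟨f, g, C, hne, hC, rfl⟩ :=
    exists_code_of_mem_achievableRates_twoLevel (m₁ := 3) (m₂ := 1 + 2) (n₁ := 3) hγ
  have hpos : 0 < C.ncard := (Set.ncard_pos (Set.toFinite C)).2 hne
  have h1 : (1 : ℝ) < Nat.card A := by exact_mod_cast hA
  rw [Real.logb_le_iff_le_rpow h1 (by exact_mod_cast hpos)]
  exact_mod_cast ncard_le_card_pow_three hC

/-! ### The binary upper bound -/

theorem exists_ge_of_sum_ge_seven {ι : Type*} [Fintype ι] [DecidableEq ι]
    (hι : Fintype.card ι = 4) (n : ι → ℕ) (hn : ∀ c, n c ≤ 2) (hsum : 7 ≤ ∑ c, n c) :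
    ∃ d, 1 ≤ n d ∧ ∀ c, c ≠ d → n c = 2 := by
  have : Nonempty ι := Fintype.card_pos_iff.1 (by omega)
  obtain ⟨d, -, hd⟩ := Finset.exists_min_image Finset.univ n Finset.univ_nonempty
  have bound (S : Finset ι) : ∑ c ∈ S, n c ≤ S.card * 2 :=
    Finset.sum_le_card_nsmul S n 2 fun c _ => hn c
  rw [← Finset.add_sum_erase _ _ (Finset.mem_univ d)] at hsum
  have h1 : (Finset.univ.erase d).card = 3 := by
    rw [Finset.card_erase_of_mem (Finset.mem_univ _), Finset.card_univ, hι]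
  refine ⟨d, ?_, fun c hc => ?_⟩
  · have := bound (Finset.univ.erase d)
    omega
  · have hmem : c ∈ Finset.univ.erase d := Finset.mem_erase.2 ⟨hc, Finset.mem_univ _⟩
    rw [← Finset.add_sum_erase _ _ hmem] at hsum
    have := bound ((Finset.univ.erase d).erase c)
    rw [Finset.card_erase_of_mem hmem, h1] at this
    have := hd c (Finset.mem_univ _)
    have := hn c
    omega

/-- With seven codewords in four classes of size at most two, three classes are full and the
remaining class `d` is nonempty. The first parts in a full class are complementary, so every word is
within distance one of one of them. -/
theorem ncard_le_six {f : (Fin 3 → ZMod 2) → Fin 3 → ZMod 2}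
    {g : (Fin 3 → ZMod 2) → Fin 2 → ZMod 2} {C : Set ((Fin 3 → ZMod 2) × (Fin 3 → ZMod 2))}
    (hC : ∀ x ∈ C, ∀ x' ∈ C, x ≠ x' → ∀ a b a' b',
      hammingDist a x.1 + hammingDist b x.2 ≤ 1 →
      hammingDist a' x'.1 + hammingDist b' x'.2 ≤ 1 → f a = f a' → g b ≠ g b') :
    C.ncard ≤ 6 := by
  classical
  by_contra! hcard
  rw [Set.ncard_eq_toFinset_card' C,
    Finset.card_eq_sum_card_fiberwise (f := fun x => g x.2) (t := Finset.univ)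
      (fun _ _ => Finset.mem_univ _)] at hcard
  obtain ⟨d, hd, hfull⟩ := exists_ge_of_sum_ge_seven (by decide) _ (fun c => by
    refine (Finset.card_le_card_of_injOn (t := (Finset.univ : Finset (ZMod 2)))
      (fun x => x.1 0) (fun _ _ => Finset.mem_univ _) ?_).trans_eq (by decide)
    intro x hx x' hx' h
    simp only [Finset.coe_filter, Set.mem_toFinset, Set.mem_ofPred_eq] at hx hx'
    by_contra hne
    exact apply_ne_of_apply_eq hC hx.1 hx'.1 hne (hx.2.trans hx'.2.symm) 0 h) hcard
  -- The adversary can spend its error for `x` on the first part, turning it into `w.1`, and its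
  -- error for `w` at `v₂`.
  have avoid {w x} (hw : w ∈ C) (hx : x ∈ C) (hne : g w.2 ≠ g x.2) (h : hammingDist w.1 x.1 ≤ 1)
      {b} (hb : hammingDist b w.2 ≤ 1) : g b ≠ g x.2 :=
    hC w hw x hx (fun e => hne (by rw [e])) w.1 b w.1 x.2 (by simpa using hb) (by simpa using h)
      rfl
  have near (w : Fin 3 → ZMod 2) {c} (hc : c ≠ d) :
      ∃ x ∈ C, g x.2 = c ∧ hammingDist w x.1 ≤ 1 := by
    obtain ⟨x, hx, x', hx', hne⟩ := Finset.one_lt_card.1 (by rw [hfull c hc]; norm_num)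
    simp only [Finset.mem_filter, Set.mem_toFinset] at hx hx'
    have hk := apply_ne_of_apply_eq hC hx.1 hx'.1 hne (hx.2.trans hx'.2.symm)
    have bits : ∀ u v w : Fin 3 → ZMod 2, (∀ k, u k ≠ v k) →
        hammingDist w u ≤ 1 ∨ hammingDist w v ≤ 1 := by decide +kernel
    rcases bits _ _ w hk with h | h
    · exact ⟨x, hx.1, hx.2, h⟩
    · exact ⟨x', hx'.1, hx'.2, h⟩
  obtain ⟨w, hw⟩ := Finset.card_pos.1 hd
  simp only [Finset.mem_filter, Set.mem_toFinset] at hw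
  obtain ⟨hw, rfl⟩ := hw
  -- Any other value would be that of a full class, which has a codeword near `w.1`.
  have hwconst {b} (hb : hammingDist b w.2 ≤ 1) : g b = g w.2 := by
    by_contra hne
    obtain ⟨x, hx, hgx, hwx⟩ := near w.1 hne
    exact avoid hw hx (hgx ▸ Ne.symm hne) hwx hb hgx.symm
  -- The codeword of class `c` is taken near `w.1`, so that `w` itself excludes the value of the
  -- class that need not be full.
  have const {c} (hc : c ≠ g w.2) : ∃ y, ∀ b, hammingDist b y ≤ 1 → g b = c := by
    obtain ⟨x, hx, rfl, hwx⟩ := near w.1 hc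
    refine ⟨x.2, fun b hb => ?_⟩
    by_contra hne
    by_cases hbw : g b = g w.2
    · exact avoid hx hw hc (by rwa [hammingDist_comm]) hb hbw
    · obtain ⟨z, hz, hgz, hxz⟩ := near x.1 hbw
      exact avoid hx hz (hgz ▸ Ne.symm hne) hxz hb hgz.symm
  obtain ⟨c, c', hc, hc', hcc'⟩ :
      ∃ c c' : Fin 2 → ZMod 2, c ≠ g w.2 ∧ c' ≠ g w.2 ∧ c ≠ c' := by
    generalize g w.2 = d
    revert d
    decide +kernel
  obtain ⟨y, hy⟩ := const hc
  obtain ⟨y', hy'⟩ := const hc'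
  -- Among three binary words two share their first symbol, so their unit balls meet.
  have bit : ∀ u v w : ZMod 2, u = v ∨ u = w ∨ v = w := by decide
  rcases bit (w.2 0) (y 0) (y' 0) with h | h | h <;>
    obtain ⟨z, h1, h2⟩ := exists_hammingDist_le_one_of_eq h
  · exact hc ((hy z h2).symm.trans (hwconst h1))
  · exact hc' ((hy' z h2).symm.trans (hwconst h1))
  · exact hcc' ((hy z h1).symm.trans (hy' z h2))

theorem le_logb_six_of_mem_achievableRates {γ : ℝ}
    (hγ : γ ∈ networkS312.achievableRates (ZMod 2) networkS312.sourceEdges 1) :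
    γ ≤ Real.logb 2 6 := by
  obtain ⟨f, g, C, hne, hC, rfl⟩ :=
    exists_code_of_mem_achievableRates_twoLevel (m₁ := 3) (m₂ := 1 + 2) (n₁ := 3) hγ
  have hpos : 0 < C.ncard := (Set.ncard_pos (Set.toFinite C)).2 hne
  have h6 : (C.ncard : ℝ) ≤ 6 := by exact_mod_cast ncard_le_six hC
  rw [Nat.card_zmod]
  exact Real.logb_le_logb_of_le (by norm_num) (by exact_mod_cast hpos) h6

/-- This provides the maximum in the ternary case, where the exact value is not determined. -/
theorem Network.finite_achievableRates {V E : Type} (N : Network V E) (A : Type*) [Finite A]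
    (U : Set E) (t : ℕ) : (N.achievableRates A U t).Finite := by
  have := N.finite_edges
  refine (Set.finite_range fun C : Set (N.Out N.source → A) =>
    Real.logb (Nat.card A : ℝ) (C.ncard : ℝ)).subset ?_
  rintro γ ⟨F, C, -, rfl⟩
  exact ⟨C, rfl⟩

theorem theorem4p4 :
    networkS312.IsCapacity (ZMod 2) networkS312.sourceEdges 1 (Real.logb 2 6) ∧
    (∃ γ : ℝ, networkS312.IsCapacity (ZMod 3) networkS312.sourceEdges 1 γ ∧
      Real.logb 3 15 ≤ γ ∧ γ ≤ 3) ∧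
    (∀ (A : Type*) [Finite A], 4 ≤ Nat.card A →
      networkS312.IsCapacity A networkS312.sourceEdges 1 3) := by
  refine ⟨⟨logb_six_mem_achievableRates, fun _ => le_logb_six_of_mem_achievableRates⟩, ?_,
    fun A _ hA => ⟨three_mem_achievableRates hA,
      fun _ => le_three_of_mem_achievableRates (by omega)⟩⟩
  obtain ⟨γ, hγ, hmax⟩ := Set.exists_max_image _ id
    (networkS312.finite_achievableRates (ZMod 3) networkS312.sourceEdges 1)
    ⟨_, logb_fifteen_mem_achievableRates⟩
  exact ⟨γ, ⟨hγ, hmax⟩, hmax _ logb_fifteen_mem_achievableRates,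
    le_three_of_mem_achievableRates (by rw [Nat.card_zmod]; norm_num) hγ⟩
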